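/- Let $\mathrm{REF}(\mathrm{inf})$ be the first-order theory in the language $\{E_n : n\in\omega\}$ of countably many binary relation symbols which asserts that each $E_n$ is an equivalence relation, that $E_0$ has a single class, that each $E_{n+1}$ refines $E_n$, and that each $E_n$-class is partitioned into infinitely many $E_{n+1}$-classes. It is regarded as a sentence of $L_{\omega_1,\omega}$, the conjunction of its axioms. For a sentence $\Phi$ of $L_{\omega_1,\omega}$ in a countable language and an infinite cardinal $\lambda$, let $\mathrm{Mod}_\lambda(\Phi)$ be the set of models of $\Phi$ with universe $\lambda$, and put $\mathrm{Mod}(\Phi)=\mathrm{Mod}_{\omega}(\Phi)$. The sets $U_{\theta(\bar\alpha)}=\{M : M\models\theta(\bar\alpha)\}$, with $\theta$ a quantifier-free first-order formula and $\bar\alpha$ a finite tuple from $\lambda$, form the sub-basis of the topology of $\mathrm{Mod}_\lambda(\Phi)$; a subset of $\mathrm{Mod}_\lambda(\Phi)$ is $\lambda$-Borel if it belongs to the least family that contains the sub-basis and is closed under complements and under unions of at most $\lambda$ members. Two structures are $\equiv_{\infty,\omega}$-equivalent if they satisfy the same sentences of $L_{\infty,\omega}$. The sentence $\Phi$ is Borel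 complete if for every sentence $\Psi$ of $L'_{\omega_1,\omega}$ in a countable language $L'$ there is a Borel map $f:\mathrm{Mod}(\Psi)\to\mathrm{Mod}(\Phi)$ such that, for all $M,N\in\mathrm{Mod}(\Psi)$, $M\cong N$ if and only if $f(M)\cong f(N)$. The sentence $\Phi$ is $\lambda$-Borel complete if for every sentence $\Psi$ of $L'_{\omega_1,\omega}$ in a countable language $L'$ there is a map $f:\mathrm{Mod}_\lambda(\Psi)\to\mathrm{Mod}_\lambda(\Phi)$ such that the inverse image of every sub-basic open set is $\lambda$-Borel and, for all $M,N\in\mathrm{Mod}_\lambda(\Psi)$, $M\equiv_{\infty,\omega}N$ if and only if $f(M)\equiv_{\infty,\omega}f(N)$. Theorem. $\mathrm{REF}(\mathrm{inf})$ is Borel complete. Indeed, for each infinite cardinal $\lambda$, $\mathrm{REF}(\mathrm{inf})$ is $\lambda$-Borel complete. -/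

import Mathlib

open Cardinal FirstOrder

universe u v w x

namespace BorelComplexity

/-! ### Infinitary logic -/

/-- Formulas of the infinitary logic `L_{κ,ω}` whose free variables are among `x_0, …, x_{n-1}`:
conjunctions of fewer than `κ` formulas, and quantification over one variable at a time.
Negation, disjunctions and existential quantifiers are expressed as usual through
`falsum`, `imp`, `conj` and `all`. -/
inductive InfFormula (L : FirstOrder.Language.{u, v}) (κ : Cardinal.{w}) : ℕ → Type (max u v (w + 1))
  | falsum {n : ℕ} : InfFormula L κ n
  | equal {n : ℕ} (s t : L.Term (Fin n)) : InfFormula L κ n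
  | rel {n l : ℕ} (R : L.Relations l) (ts : Fin l → L.Term (Fin n)) : InfFormula L κ n
  | imp {n : ℕ} (φ ψ : InfFormula L κ n) : InfFormula L κ n
  | conj {n : ℕ} (ι : Type w) (hι : #ι < κ) (φ : ι → InfFormula L κ n) : InfFormula L κ n
  | all {n : ℕ} (φ : InfFormula L κ (n + 1)) : InfFormula L κ n

/-- Sentences of `L_{κ,ω}`. -/
abbrev InfSentence (L : FirstOrder.Language.{u, v}) (κ : Cardinal.{w}) : Type (max u v (w + 1)) :=
  InfFormula L κ 0

/-- Satisfaction of a formula of `L_{κ,ω}`; the bound variable of `all φ` is the last one. -/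
def InfFormula.Realize {L : FirstOrder.Language.{u, v}} {κ : Cardinal.{w}} {X : Type x} [L.Structure X] :
    {n : ℕ} → InfFormula L κ n → (Fin n → X) → Prop
  | _, .falsum, _ => False
  | _, .equal s t, a => s.realize a = t.realize a
  | _, .rel R ts, a => Language.Structure.RelMap R fun i => (ts i).realize a
  | _, .imp φ ψ, a => φ.Realize a → ψ.Realize a
  | _, .conj _ _ φ, a => ∀ i, (φ i).Realize a
  | _, .all φ, a => ∀ b : X, φ.Realize (Fin.snoc a b)

/-- `X ⊨ Φ` for a sentence `Φ` of `L_{κ,ω}`. -/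
def InfSentence.Holds {L : FirstOrder.Language.{u, v}} {κ : Cardinal.{w}} (Φ : InfSentence L κ)
    (X : Type x) [L.Structure X] : Prop :=
  InfFormula.Realize Φ (Fin.elim0 : Fin 0 → X)

/-- Every first-order formula is a formula of `L_{κ,ω}`. -/
def InfFormula.ofFirstOrder {L : FirstOrder.Language.{u, v}} {κ : Cardinal.{w}} :
    {n : ℕ} → L.BoundedFormula Empty n → InfFormula L κ n
  | _, .falsum => .falsum
  | _, .equal s t =>
      .equal (s.relabel (Sum.elim Empty.elim id)) (t.relabel (Sum.elim Empty.elim id))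
  | _, .rel R ts => .rel R fun i => (ts i).relabel (Sum.elim Empty.elim id)
  | _, .imp φ ψ => .imp (ofFirstOrder φ) (ofFirstOrder ψ)
  | _, .all φ => .all (ofFirstOrder φ)

theorem InfFormula.realize_ofFirstOrder {L : FirstOrder.Language.{u, v}} {κ : Cardinal.{w}} {X : Type x}
    [L.Structure X] {n : ℕ} (φ : L.BoundedFormula Empty n) (a : Fin n → X) :
    (ofFirstOrder φ : InfFormula L κ n).Realize a ↔ φ.Realize default a := by
  have key : ∀ {m : ℕ} (b : Fin m → X),
      b ∘ (Sum.elim Empty.elim id : Empty ⊕ Fin m → Fin m) = Sum.elim default b := by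
    intro m b
    funext i
    rcases i with i | i
    · exact i.elim
    · rfl
  induction φ with
  | falsum => rfl
  | equal s t =>
    simp [ofFirstOrder, Realize, Language.BoundedFormula.Realize, Language.Term.realize_relabel,
      key]
  | rel R ts =>
    simp [ofFirstOrder, Realize, Language.BoundedFormula.Realize, Language.Term.realize_relabel,
      key]
  | imp φ ψ ih1 ih2 =>
    simp [ofFirstOrder, Realize, Language.BoundedFormula.Realize, ih1, ih2]
  | all φ ih =>
    simp [ofFirstOrder, Realize, Language.BoundedFormula.Realize, ih]

/-- The sentence of `L_{ω₁,ω}` that axiomatizes a countable first-order theory: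
the conjunction of its axioms. -/
noncomputable def InfSentence.ofTheory {L : FirstOrder.Language.{0, 0}} (T : L.Theory) (hT : T.Countable) :
    InfSentence L (ℵ₁ : Cardinal.{0}) :=
  .conj T (Cardinal.succ_aleph0 ▸ Order.lt_succ_of_le (Cardinal.le_aleph0_iff_set_countable.2 hT))
    fun φ => .ofFirstOrder φ.1

theorem InfSentence.holds_ofTheory {L : FirstOrder.Language.{0, 0}} (T : L.Theory) (hT : T.Countable)
    (X : Type x) [L.Structure X] : (InfSentence.ofTheory T hT).Holds X ↔ X ⊨ T := by
  rw [Language.Theory.model_iff]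
  simp only [InfSentence.Holds, InfSentence.ofTheory, InfFormula.Realize, Subtype.forall]
  refine forall₂_congr fun φ _ => ?_
  rw [InfFormula.realize_ofFirstOrder, Language.Sentence.Realize, Language.Formula.Realize,
    Subsingleton.elim (Fin.elim0 : Fin 0 → X) default]

/-- `M ≡_{∞,ω} N`: the structures satisfy the same sentences of `L_{∞,ω} = ⋃_κ L_{κ,ω}`. -/
def InfEquiv (L : FirstOrder.Language.{0, 0}) (M N : Type u) [L.Structure M] [L.Structure N] : Prop :=
  ∀ (κ : Cardinal.{u}) (φ : InfSentence L κ), φ.Holds M ↔ φ.Holds N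

/-! ### Spaces of models -/

/-- The models of the sentence `Φ` of `L_{ω₁,ω}` whose universe is `X`. -/
def Mod {L : FirstOrder.Language.{0, 0}} (Φ : InfSentence L (ℵ₁ : Cardinal.{0})) (X : Type u) : Type u :=
  {S : L.Structure X // @InfSentence.Holds _ _ Φ X S}

namespace Mod

variable {L : FirstOrder.Language.{0, 0}} {Φ : InfSentence L (ℵ₁ : Cardinal.{0})} {X : Type u}

/-- The set `U_{θ(ā)}` of the models that satisfy `θ(ā)`. -/
def basicSet (Φ : InfSentence L (ℵ₁ : Cardinal.{0})) {n : ℕ} (θ : L.Formula (Fin n))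
    (a : Fin n → X) : Set (Mod Φ X) :=
  {M | @Language.Formula.Realize L X M.1 (Fin n) θ a}

/-- The sub-basis: all the `U_{θ(ā)}` with `θ` quantifier-free and `ā` a finite tuple from `X`. -/
def subbasis (Φ : InfSentence L (ℵ₁ : Cardinal.{0})) (X : Type u) : Set (Set (Mod Φ X)) :=
  {U | ∃ (n : ℕ) (θ : L.Formula (Fin n)) (a : Fin n → X), θ.IsQF ∧ U = basicSet Φ θ a}

/-- The logic topology. -/
instance : TopologicalSpace (Mod Φ X) := TopologicalSpace.generateFrom (subbasis Φ X)

/-- Isomorphism of two models with universe `X`. -/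
def Iso (M N : Mod Φ X) : Prop :=
  Nonempty (@Language.Equiv L X X M.1 N.1)

/-- `≡_{∞,ω}` for two models with universe `X`. -/
def Equivalent (M N : Mod Φ X) : Prop :=
  @InfEquiv L X X M.1 N.1

end Mod

/-! ### Borel completeness -/

/-- `(Mod(Ψ), ≅)` is Borel reducible to `(Mod(Φ), ≅)`; the universe of the models is `ℕ`. -/
def BorelReducible {L' L : FirstOrder.Language.{0, 0}} (Ψ : InfSentence L' (ℵ₁ : Cardinal.{0}))
    (Φ : InfSentence L (ℵ₁ : Cardinal.{0})) : Prop :=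
  ∃ f : Mod Ψ ℕ → Mod Φ ℕ,
    @Measurable _ _ (borel (Mod Ψ ℕ)) (borel (Mod Φ ℕ)) f ∧
      ∀ M N : Mod Ψ ℕ, M.Iso N ↔ (f M).Iso (f N)

/-- `Φ` is Borel complete: for every sentence `Ψ` of `L'_{ω₁,ω}` in a countable language `L'`,
`(Mod(Ψ), ≅)` is Borel reducible to `(Mod(Φ), ≅)`. -/
def BorelComplete {L : FirstOrder.Language.{0, 0}} (Φ : InfSentence L (ℵ₁ : Cardinal.{0})) : Prop :=
  ∀ (L' : FirstOrder.Language.{0, 0}) (_ : Countable L'.Symbols) (Ψ : InfSentence L' (ℵ₁ : Cardinal.{0})),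
    BorelReducible Ψ Φ

/-! ### `λ`-Borel completeness -/

/-- The `λ⁺`-algebra of subsets of `Y` generated by `B`: the least family that contains `B` and is
closed under complements and under unions of at most `λ` members. -/
inductive LambdaBorel (lam : Cardinal.{u}) {Y : Type u} (B : Set (Set Y)) : Set Y → Prop
  | basic (U : Set Y) (hU : U ∈ B) : LambdaBorel lam B U
  | compl (U : Set Y) (hU : LambdaBorel lam B U) : LambdaBorel lam B Uᶜ
  | iUnion (ι : Type u) (hι : #ι ≤ lam) (U : ι → Set Y) (hU : ∀ i, LambdaBorel lam B (U i)) :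
      LambdaBorel lam B (⋃ i, U i)

/-- `Mod_λ(Φ)`: the models of `Φ` whose universe is the set of ordinals below `λ`. -/
abbrev ModLambda {L : FirstOrder.Language.{0, 0}} (lam : Cardinal.{u})
    (Φ : InfSentence L (ℵ₁ : Cardinal.{0})) : Type u :=
  Mod Φ lam.ord.ToType

/-- `(Mod_λ(Ψ), ≡_{∞,ω})` is `λ`-Borel reducible to `(Mod_λ(Φ), ≡_{∞,ω})`. -/
def LambdaBorelReducible {L' L : FirstOrder.Language.{0, 0}} (lam : Cardinal.{u})
    (Ψ : InfSentence L' (ℵ₁ : Cardinal.{0})) (Φ : InfSentence L (ℵ₁ : Cardinal.{0})) : Prop :=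
  ∃ f : ModLambda lam Ψ → ModLambda lam Φ,
    (∀ U ∈ Mod.subbasis Φ lam.ord.ToType,
      LambdaBorel lam (Mod.subbasis Ψ lam.ord.ToType) (f ⁻¹' U)) ∧
      ∀ M N : ModLambda lam Ψ, M.Equivalent N ↔ (f M).Equivalent (f N)

/-- `Φ` is `λ`-Borel complete: for every sentence `Ψ` of `L'_{ω₁,ω}` in a countable language `L'`,
`(Mod_λ(Ψ), ≡_{∞,ω})` is `λ`-Borel reducible to `(Mod_λ(Φ), ≡_{∞,ω})`. -/
def LambdaBorelComplete {L : FirstOrder.Language.{0, 0}} (lam : Cardinal.{u})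
    (Φ : InfSentence L (ℵ₁ : Cardinal.{0})) : Prop :=
  ∀ (L' : FirstOrder.Language.{0, 0}) (_ : Countable L'.Symbols) (Ψ : InfSentence L' (ℵ₁ : Cardinal.{0})),
    LambdaBorelReducible lam Ψ Φ

/-! ### Infinitely splitting, refining equivalence relations -/

/-- The relation symbols `E n`, all binary. -/
inductive RefRel : ℕ → Type
  | E (n : ℕ) : RefRel 2

/-- The language `{E_n : n ∈ ω}`. -/
def refLanguage : FirstOrder.Language.{0, 0} := ⟨fun _ => Empty, RefRel⟩

/-- The relation symbol `E_n`. -/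
def symE (n : ℕ) : refLanguage.Relations 2 := RefRel.E n

/-- `E_0` has a single class: `∀ x y, E_0(x, y)`. -/
def axTrivial : refLanguage.Sentence :=
  ((symE 0).boundedFormula₂ (&0) (&1) : refLanguage.BoundedFormula Empty 2).alls

/-- `E_{n+1}` refines `E_n`: `∀ x y, E_{n+1}(x, y) → E_n(x, y)`. -/
def axRefine (n : ℕ) : refLanguage.Sentence :=
  ((symE (n + 1)).boundedFormula₂ (&0) (&1) ⟹ (symE n).boundedFormula₂ (&0) (&1) :
    refLanguage.BoundedFormula Empty 2).alls

/-- Every `E_n`-class contains at least `k` classes of `E_{n+1}`: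
`∀ x, ∃ y_0 … y_{k-1}, ⋀_i E_n(x, y_i) ∧ ⋀_{i ≠ j} ¬ E_{n+1}(y_i, y_j)`. -/
noncomputable def axSplit (n k : ℕ) : refLanguage.Sentence :=
  Language.Formula.iAlls (α := Empty) (Fin 1) <|
    Language.Formula.iExs (α := Empty ⊕ Fin 1) (Fin k) <|
      (Language.Formula.iInf fun i : Fin k =>
        (symE n).formula₂ (Language.Term.var (Sum.inl (Sum.inr 0)))
          (Language.Term.var (Sum.inr i))) ⊓
      (Language.Formula.iInf fun p : {p : Fin k × Fin k // p.1 ≠ p.2} =>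
        ∼((symE (n + 1)).formula₂ (Language.Term.var (Sum.inr p.1.1))
          (Language.Term.var (Sum.inr p.1.2))))

/-- The first-order theory `REF(inf)`. -/
def refInfTheory : refLanguage.Theory :=
  {axTrivial} ∪ (Set.range fun n => (symE n).reflexive) ∪ (Set.range fun n => (symE n).symmetric) ∪
    (Set.range fun n => (symE n).transitive) ∪ Set.range axRefine ∪
    Set.range fun p : ℕ × ℕ => axSplit p.1 p.2

theorem countable_refInfTheory : refInfTheory.Countable := by
  unfold refInfTheory
  refine ((((Set.Countable.union ?_ ?_).union ?_).union ?_).union ?_).union ?_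
  · exact Set.countable_singleton _
  all_goals exact Set.countable_range _

/-- `REF(inf)` as a sentence of `L_{ω₁,ω}`. -/
noncomputable def refInf : InfSentence refLanguage (ℵ₁ : Cardinal.{0}) :=
  InfSentence.ofTheory refInfTheory countable_refInfTheory

section Meaning

open FirstOrder.Language

/-- The models of `refInf` are the infinitely splitting, refining equivalence relations. -/
theorem holds_refInf_iff (X : Type x) [refLanguage.Structure X] :
    refInf.Holds X ↔
      (∀ n, Equivalence fun a b : X => Structure.RelMap (symE n) ![a, b]) ∧
      (∀ a b : X, Structure.RelMap (symE 0) ![a, b]) ∧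
      (∀ n, ∀ a b : X, Structure.RelMap (symE (n + 1)) ![a, b] →
        Structure.RelMap (symE n) ![a, b]) ∧
      ∀ n k, ∀ a : X, ∃ b : Fin k → X, (∀ i, Structure.RelMap (symE n) ![a, b i]) ∧
        ∀ i j, i ≠ j → ¬ Structure.RelMap (symE (n + 1)) ![b i, b j] := by
  have h0 : X ⊨ axTrivial ↔ ∀ a b : X, Structure.RelMap (symE 0) ![a, b] := by
    simp only [axTrivial, Sentence.Realize, Formula.Realize, BoundedFormula.alls,
      BoundedFormula.realize_all, BoundedFormula.realize_rel₂]
    rfl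
  have h1 : ∀ n, X ⊨ axRefine n ↔ ∀ a b : X, Structure.RelMap (symE (n + 1)) ![a, b] →
        Structure.RelMap (symE n) ![a, b] := by
    intro n
    simp only [axRefine, Sentence.Realize, Formula.Realize, BoundedFormula.alls,
      BoundedFormula.realize_all, BoundedFormula.realize_rel₂, BoundedFormula.realize_imp]
    rfl
  have h2 : ∀ n k, X ⊨ axSplit n k ↔ ∀ a : X, ∃ b : Fin k → X,
      (∀ i, Structure.RelMap (symE n) ![a, b i]) ∧
        ∀ i j, i ≠ j → ¬ Structure.RelMap (symE (n + 1)) ![b i, b j] := by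
    intro n k
    simp only [axSplit, Sentence.Realize, Formula.realize_iAlls, Formula.realize_iExs,
      Formula.realize_inf, Formula.realize_iInf, Formula.realize_not, Formula.realize_rel₂,
      Term.realize_var, Sum.elim_inl, Sum.elim_inr, Subtype.forall, Prod.forall]
    constructor
    · intro h a
      exact h fun _ => a
    · intro h a
      exact h (a 0)
  simp only [refInf, InfSentence.holds_ofTheory, refInfTheory, Theory.model_union_iff]
  simp only [Theory.model_iff, Set.mem_singleton_iff, forall_eq, Set.forall_mem_range, h0, h1, h2,
    Prod.forall, Relations.realize_reflexive, Relations.realize_symmetric,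
    Relations.realize_transitive]
  constructor
  · rintro ⟨⟨⟨⟨⟨a, b⟩, c⟩, d⟩, e⟩, f⟩
    exact ⟨fun n => ⟨(b n).refl, fun {x y} => (c n).symm x y, fun {x y z} => (d n).trans x y z⟩, a, e, f⟩
  · rintro ⟨a, b, c, d⟩
    exact ⟨⟨⟨⟨⟨b, fun n => ⟨(a n).refl⟩⟩, fun n => ⟨fun _ _ => (a n).symm⟩⟩,
      fun n => ⟨fun _ _ _ => (a n).trans⟩⟩, c⟩, d⟩

end Meaning

end BorelComplexity

namespace BorelComplexity

open FirstOrder.Language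

/-! ### Back-and-forth systems -/

/-! Both equivalence relations reduce to one notion: `infEquiv_iff_backForth` (Karp) does this for
$\equiv_{\infty,\omega}$, and `nonempty_equiv_iff_backForth` (Scott) for isomorphism of countable
structures. A single coding that preserves and reflects back-and-forth equivalence therefore serves
both claims.

Stage one turns a structure on $X$ into a coloured tree. The finite tuples carry colours in $\mathbb
N$; passing from $t$ to a child changes the colour from $c$ to $2c$ or $2c+1$, the new digit being
the truth value of the next formula in a list of atomic formulas. Since every formula recurs in the
list, the colours retain the whole atomic diagram (`backForth_colouring_iff`).

Stage two turns a coloured tree into a model of REF(inf). Consider eventually resting sequences of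
moves on the tree (stay, die, append an element), each move existing in infinitely many copies, and
let $E_n$ be agreement of the first $n$ moves. The elements on one path are $E_n$-equivalent for all
$n$, and their number is the information carried: exactly the colour of the final tuple, or infinite
for a dead path (`encard_pathOf`). Dead paths also absorb the surplus elements, so the universe can
remain $X$.

Related trees give related models because the copies of moves always leave a fresh matching branch
(`backForth_pathOf`). Conversely, the sizes reveal the colour at every level of a path: resting
there realises the colour, and later colours never decrease (`weight_run_eq_of_backForth`). As a
child's colour is finite and strictly larger than its parent's, a matching path can neither stay nor
die when an element is appended, so it appends one too (`ReachRel.exists_snoc`).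

The coding is measurable because each element has only two possible paths, and a comparison of one
colour with a constant decides between them. -/

/-- A relation between tuples of `M` and of `N` that has the back-and-forth property and is
contained in `P`. -/
structure IsBackForth {M N : Type u} (P B : ∀ n, (Fin n → M) → (Fin n → N) → Prop) : Prop where
  sub : ∀ {n a b}, B n a b → P n a b
  forth : ∀ {n a b}, B n a b → ∀ c, ∃ d, B (n + 1) (Fin.snoc a c) (Fin.snoc b d)
  back : ∀ {n a b}, B n a b → ∀ d, ∃ c, B (n + 1) (Fin.snoc a c) (Fin.snoc b d)

/-- The empty tuples are related by a back-and-forth system contained in `P`. -/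
def BackForth {M N : Type u} (P : ∀ n, (Fin n → M) → (Fin n → N) → Prop) : Prop :=
  ∃ B, IsBackForth P B ∧ B 0 Fin.elim0 Fin.elim0

/-- Iterates `forth`. It serves to add several chosen elements at once, and to lengthen tuples
without losing the relation. -/
theorem IsBackForth.extend {M N : Type u} {P B : ∀ n, (Fin n → M) → (Fin n → N) → Prop}
    (h : IsBackForth P B) {n : ℕ} {a : Fin n → M} {b : Fin n → N} (hab : B n a b) (k : ℕ)
    (z : Fin k → M) :
    ∃ a' b', B (n + k) a' b' ∧ (∀ i, a' (Fin.castAdd k i) = a i) ∧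
      (∀ i, b' (Fin.castAdd k i) = b i) ∧ ∀ i, a' (Fin.natAdd n i) = z i := by
  induction k with
  | zero => exact ⟨a, b, hab, fun _ => rfl, fun _ => rfl, fun i => i.elim0⟩
  | succ k ih =>
    obtain ⟨a', b', hB, ha, hb, hz⟩ := ih fun i => z i.castSucc
    obtain ⟨d, hd⟩ := h.forth hB (z (Fin.last k))
    refine ⟨_, _, hd, fun i => ?_, fun i => ?_, fun i => ?_⟩
    · rw [← ha i]
      exact Fin.snoc_castSucc (α := fun _ => M) _ _ (Fin.castAdd k i)
    · rw [← hb i]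
      exact Fin.snoc_castSucc (α := fun _ => N) _ _ (Fin.castAdd k i)
    · induction i using Fin.lastCases with
      | last => exact Fin.snoc_last (α := fun _ => M) _ _
      | cast i =>
        rw [← hz i]
        exact Fin.snoc_castSucc (α := fun _ => M) _ _ (Fin.natAdd n i)

/-- Two tuples satisfy the same atomic formulas. -/
def AtomicEquiv {L : FirstOrder.Language.{0, 0}} {M N : Type u} (SM : L.Structure M)
    (SN : L.Structure N) (n : ℕ) (a : Fin n → M) (b : Fin n → N) : Prop :=
  ∀ θ : L.Formula (Fin n), θ.IsAtomic → (θ.Realize a ↔ θ.Realize b)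

/-! ### Karp's theorem and enumerations from back-and-forth systems. -/

section Karp

variable {L : FirstOrder.Language.{0, 0}} {M N : Type u} {SM : L.Structure M} {SN : L.Structure N}

theorem AtomicEquiv.comp {n k : ℕ} {a : Fin n → M} {b : Fin n → N} (h : AtomicEquiv SM SN n a b)
    (g : Fin k → Fin n) : AtomicEquiv SM SN k (a ∘ g) (b ∘ g) := by
  intro θ hθ
  have := h (θ.relabel g) (hθ.relabel _)
  rwa [Formula.realize_relabel, Formula.realize_relabel] at this

theorem atomicEquiv_iff {n : ℕ} {a : Fin n → M} {b : Fin n → N} :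
    AtomicEquiv SM SN n a b ↔
      (∀ s t : L.Term (Fin n), s.realize a = t.realize a ↔ s.realize b = t.realize b) ∧
      ∀ (l : ℕ) (R : L.Relations l) (ts : Fin l → L.Term (Fin n)),
        (Structure.RelMap R fun i => (ts i).realize a) ↔
          Structure.RelMap R fun i => (ts i).realize b := by
  constructor
  · intro h
    refine ⟨fun s t => ?_, fun l R ts => ?_⟩
    · have := h (s.equal t) (.equal _ _)
      rwa [Formula.realize_equal, Formula.realize_equal] at this
    · have := h (R.formula ts) (.rel _ _)
      rwa [Formula.realize_rel, Formula.realize_rel] at this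
  · rintro ⟨h1, h2⟩ θ hθ
    have key : ∀ {X : Type u} (c : Fin n → X), (Sum.elim c default : Fin n ⊕ Fin 0 → X) =
        c ∘ Sum.elim id Fin.elim0 := by
      intro X c
      funext i
      rcases i with i | i
      · rfl
      · exact i.elim0
    cases hθ with
    | equal s t =>
      have := h1 (s.relabel (Sum.elim id Fin.elim0)) (t.relabel (Sum.elim id Fin.elim0))
      simpa only [Formula.Realize, BoundedFormula.realize_bdEqual, key, Term.realize_relabel]
        using this
    | rel R ts =>
      have := h2 _ R fun i => (ts i).relabel (Sum.elim id Fin.elim0)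
      simpa only [Formula.Realize, BoundedFormula.realize_rel, key, Term.realize_relabel]
        using this

theorem IsBackForth.realize_iff {B : ∀ n, (Fin n → M) → (Fin n → N) → Prop}
    (h : IsBackForth (AtomicEquiv SM SN) B) {κ : Cardinal.{w}} {n : ℕ} (φ : InfFormula L κ n)
    {a : Fin n → M} {b : Fin n → N} (hab : B n a b) : φ.Realize a ↔ φ.Realize b := by
  induction φ with
  | falsum => exact Iff.rfl
  | equal s t => exact (atomicEquiv_iff.1 (h.sub hab)).1 s t
  | rel R ts => exact (atomicEquiv_iff.1 (h.sub hab)).2 _ R ts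
  | imp φ ψ ih1 ih2 => exact imp_congr (ih1 hab) (ih2 hab)
  | conj ι hι φ ih => exact forall_congr' fun i => ih i hab
  | all φ ih =>
    constructor
    · intro H d
      obtain ⟨c, hc⟩ := h.back hab d
      exact (ih hc).1 (H c)
    · intro H c
      obtain ⟨d, hd⟩ := h.forth hab c
      exact (ih hd).2 (H d)


/-- Tuples that satisfy the same formulas of `L_{κ,ω}` can be extended to such tuples,
if `κ` exceeds the size of one of the structures. -/
theorem exists_realize_iff_snoc {κ : Cardinal.{u}} (hN : #N < κ) {n : ℕ} {a : Fin n → M}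
    {b : Fin n → N} (h : ∀ φ : InfFormula L κ n, φ.Realize a ↔ φ.Realize b) (c : M) :
    ∃ d : N, ∀ φ : InfFormula L κ (n + 1),
      φ.Realize (Fin.snoc a c : Fin (n + 1) → M) ↔ φ.Realize (Fin.snoc b d : Fin (n + 1) → N) := by
  by_contra! H
  have H' : ∀ d : N, ∃ φ : InfFormula L κ (n + 1), φ.Realize (Fin.snoc a c : Fin (n + 1) → M) ∧
      ¬ φ.Realize (Fin.snoc b d : Fin (n + 1) → N) := by
    intro d
    obtain ⟨φ, ⟨h1, h2⟩ | ⟨h1, h2⟩⟩ := H d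
    · exact ⟨φ, h1, h2⟩
    · exact ⟨.imp φ .falsum, h1, fun h3 => h3 h2⟩
  choose φ h1 h2 using H'
  -- The formula is $\exists x\,\bigwedge_{d\in N}\varphi_d(x)$, with a conjunction indexed by $N$;
  -- this is where `#N < κ` is needed. It holds at `a` through `c` and fails at `b`, since each `d`
  -- violates its own $\varphi_d$.
  have h3 := h (.imp (.all (.imp (.conj N hN φ) .falsum)) .falsum)
  refine absurd (h3.1 fun h4 => h4 c h1) fun h4 => ?_
  exact h4 fun d h5 => h2 d (h5 d)

/-- Karp's theorem. -/
theorem infEquiv_iff_backForth : @InfEquiv L M N SM SN ↔ BackForth (AtomicEquiv SM SN) := by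
  constructor
  · intro h
    obtain ⟨κ, hκ⟩ : ∃ κ : Cardinal.{u}, #M < κ ∧ #N < κ :=
      ⟨Order.succ (max #M #N), Order.lt_succ_of_le (le_max_left _ _),
        Order.lt_succ_of_le (le_max_right _ _)⟩
    refine ⟨fun n a b => ∀ φ : InfFormula L κ n, φ.Realize a ↔ φ.Realize b,
      ⟨fun {n a b} hab => ?_, fun hab c => exists_realize_iff_snoc hκ.2 hab c, fun hab d => ?_⟩,
      h κ⟩
    · exact atomicEquiv_iff.2 ⟨fun s t => hab (.equal s t), fun l R ts => hab (.rel R ts)⟩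
    · obtain ⟨c, hc⟩ := exists_realize_iff_snoc hκ.1 (fun φ => (hab φ).symm) d
      exact ⟨c, fun φ => (hc φ).symm⟩
  · rintro ⟨B, hB, h0⟩ κ φ
    exact hB.realize_iff φ h0

/-- A back-and-forth system between countable sets gives a pair of enumerations. -/
theorem IsBackForth.exists_enumerations {M N : Type} [Countable M] [Nonempty M] [Countable N]
    [Nonempty N] {P B : ∀ n, (Fin n → M) → (Fin n → N) → Prop} (h : IsBackForth P B)
    (h0 : B 0 Fin.elim0 Fin.elim0) :
    ∃ (p : ℕ → M) (q : ℕ → N), p.Surjective ∧ q.Surjective ∧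
      ∀ n, B n (fun i => p i) fun i => q i := by
  obtain ⟨eM, hM⟩ := exists_surjective_nat M
  obtain ⟨eN, hN⟩ := exists_surjective_nat N
  -- Even stages treat the next element of `M`, odd stages the next element of `N`, so both
  -- enumerations are onto.
  have step : ∀ n (s : {s : (Fin n → M) × (Fin n → N) // B n s.1 s.2}),
      ∃ c d, B (n + 1) (Fin.snoc s.1.1 c) (Fin.snoc s.1.2 d) ∧
        (∀ k, n = 2 * k → c = eM k) ∧ ∀ k, n = 2 * k + 1 → d = eN k := by
    intro n s
    rcases Nat.even_or_odd' n with ⟨k, hk | hk⟩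
    · obtain ⟨d, hd⟩ := h.forth s.2 (eM k)
      refine ⟨eM k, d, hd, fun j hj => ?_, fun j hj => by omega⟩
      rw [show k = j by omega]
    · obtain ⟨c, hc⟩ := h.back s.2 (eN k)
      refine ⟨c, eN k, hc, fun j hj => by omega, fun j hj => ?_⟩
      rw [show k = j by omega]
  choose c d hB hc hd using step
  let F : ∀ n, {s : (Fin n → M) × (Fin n → N) // B n s.1 s.2} := fun n =>
    Nat.rec ⟨(Fin.elim0, Fin.elim0), h0⟩ (fun n s => ⟨(_, _), hB n s⟩) n
  have hF : ∀ n, (F n).1 = (fun i : Fin n => c i (F i), fun i : Fin n => d i (F i)) := by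
    intro n
    induction n with
    | zero => exact Prod.ext (funext fun i => i.elim0) (funext fun i => i.elim0)
    | succ n ih =>
      have : (F (n + 1)).1 = (Fin.snoc (F n).1.1 (c n (F n)), Fin.snoc (F n).1.2 (d n (F n))) := rfl
      rw [this]
      refine Prod.ext (funext fun i => ?_) (funext fun i => ?_)
      · induction i using Fin.lastCases with
        | last => exact Fin.snoc_last (α := fun _ => M) _ _
        | cast i => exact (Fin.snoc_castSucc (α := fun _ => M) _ _ i).trans (by rw [ih]; rfl)
      · induction i using Fin.lastCases with
        | last => exact Fin.snoc_last (α := fun _ => N) _ _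
        | cast i => exact (Fin.snoc_castSucc (α := fun _ => N) _ _ i).trans (by rw [ih]; rfl)
  refine ⟨fun n => c n (F n), fun n => d n (F n), fun m => ?_, fun m => ?_, fun n => ?_⟩
  · obtain ⟨k, rfl⟩ := hM m
    exact ⟨2 * k, hc _ _ k rfl⟩
  · obtain ⟨k, rfl⟩ := hN m
    exact ⟨2 * k + 1, hd _ _ k rfl⟩
  · have := (F n).2
    rwa [hF n] at this

end Karp

/-- Scott's theorem: countable structures related by a back-and-forth system are isomorphic. -/
theorem nonempty_equiv_iff_backForth {L : FirstOrder.Language.{0, 0}} {M N : Type} [Countable M]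
    [Nonempty M] [Countable N] [Nonempty N] {SM : L.Structure M} {SN : L.Structure N} :
    Nonempty (L.Equiv M N) ↔ BackForth (AtomicEquiv SM SN) := by
  constructor
  · rintro ⟨e⟩
    refine ⟨fun n a b => b = e ∘ a, ⟨?_, ?_, ?_⟩, funext fun i => i.elim0⟩
    · rintro n a b rfl
      refine atomicEquiv_iff.2 ⟨fun s t => ?_, fun l R ts => ?_⟩
      · rw [HomClass.realize_term, HomClass.realize_term, e.injective.eq_iff]
      · simp only [HomClass.realize_term]
        exact (e.map_rel R _).symm
    · rintro n a b rfl c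
      exact ⟨e c, (Fin.comp_snoc e a c).symm⟩
    · rintro n a b rfl d
      exact ⟨e.symm d, by rw [Fin.comp_snoc, e.apply_symm_apply]⟩
  · rintro ⟨B, hB, h0⟩
    obtain ⟨p, q, hp, hq, hpq⟩ := hB.exists_enumerations h0
    have hat : ∀ n, AtomicEquiv SM SN n (fun i => p i) fun i => q i := fun n => hB.sub (hpq n)
    have heq : ∀ i j, p i = p j ↔ q i = q j := by
      intro i j
      exact (atomicEquiv_iff.1 (hat (max i j + 1))).1
        (.var ⟨i, by omega⟩) (.var ⟨j, by omega⟩)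
    -- The isomorphism sends `p i` to `q i`, which is well defined and injective by `heq`. Functions
    -- and relations are compared on an initial segment long enough to contain indices for all the
    -- elements involved.
    choose g hg using hp
    choose g' hg' using hq
    have he : ∀ i, q (g (p i)) = q i := fun i => (heq _ _).1 (hg _)
    have bound : ∀ {l : ℕ} (x : Fin l → M), ∃ n, ∀ i, g (x i) < n := by
      intro l x
      obtain ⟨n, hn⟩ := (Set.finite_range fun i => g (x i)).bddAbove
      exact ⟨n + 1, fun i => Nat.lt_succ_of_le (hn ⟨i, rfl⟩)⟩
    refine ⟨⟨⟨fun m => q (g m), fun y => p (g' y), fun m => ?_, fun y => ?_⟩, ?_, ?_⟩⟩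
    · rw [← hg m, heq, hg', hg m]
    · exact (he _).trans (hg' y)
    · intro l f x
      obtain ⟨n, hn⟩ := bound x
      have := (atomicEquiv_iff.1 (hat (max n (g (Structure.funMap f x)) + 1))).1
        (.func f fun i => .var ⟨g (x i), by have := hn i; omega⟩)
        (.var ⟨g (Structure.funMap f x), by omega⟩)
      simp only [Term.realize, hg] at this
      exact (this.1 trivial).symm
    · intro l R x
      obtain ⟨n, hn⟩ := bound x
      have := (atomicEquiv_iff.1 (hat n)).2 l R fun i => .var ⟨g (x i), hn i⟩
      simp only [Term.realize, hg] at this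
      exact this.symm

/-! ### Models of `REF(inf)` given by sequences -/

/-- Agreement of two sequences below `n`. -/
def Agree {Y : Type u} (n : ℕ) (p q : ℕ → Y) : Prop := ∀ i < n, p i = q i

theorem Agree.symm {Y : Type u} {n : ℕ} {p q : ℕ → Y} (h : Agree n p q) : Agree n q p :=
  fun i hi => (h i hi).symm

theorem Agree.trans {Y : Type u} {n : ℕ} {p q r : ℕ → Y} (h : Agree n p q) (h' : Agree n q r) :
    Agree n p r :=
  fun i hi => (h i hi).trans (h' i hi)

theorem Agree.mono {Y : Type u} {m n : ℕ} {p q : ℕ → Y} (h : Agree n p q) (hmn : m ≤ n) :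
    Agree m p q :=
  fun i hi => h i (hi.trans_le hmn)

theorem Agree.succ {Y : Type u} {n : ℕ} {p q : ℕ → Y} (h : Agree n p q) (hn : p n = q n) :
    Agree (n + 1) p q := by
  intro i hi
  rcases Nat.lt_succ_iff_lt_or_eq.1 hi with h' | rfl
  · exact h i h'
  · exact hn

/-- The structure in which `E_n` is agreement below `n` of attached sequences. -/
@[reducible]
def prefixStructure {X : Type u} {Y : Type v} (sq : X → ℕ → Y) : refLanguage.Structure X where
  funMap f := f.elim
  RelMap
    | RefRel.E n => fun a => Agree n (sq (a 0)) (sq (a 1))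

theorem relMap_prefixStructure {X : Type u} {Y : Type v} (sq : X → ℕ → Y) (n : ℕ) (a : Fin 2 → X) :
    (prefixStructure sq).RelMap (symE n) a ↔ Agree n (sq (a 0)) (sq (a 1)) :=
  Iff.rfl

theorem holds_refInf_prefixStructure {X : Type u} {Y : Type v} (sq : X → ℕ → Y)
    (h : ∀ a n (k : ℕ), ∃ b : Fin k → X, (∀ i, Agree n (sq a) (sq (b i))) ∧
      ∀ i j, i ≠ j → sq (b i) n ≠ sq (b j) n) :
    @InfSentence.Holds _ _ refInf X (prefixStructure sq) := by
  let _ := prefixStructure sq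
  refine (holds_refInf_iff X).2 ⟨fun n => ⟨fun a i _ => rfl, fun hab => hab.symm,
    fun hab hbc => hab.trans hbc⟩, fun a b i hi => absurd hi (Nat.not_lt_zero _),
    fun n a b hab => hab.mono (Nat.le_succ n), fun n k a => ?_⟩
  obtain ⟨b, hb, hne⟩ := h a n k
  exact ⟨b, hb, fun i j hij hag => hne i j hij (hag n (Nat.lt_succ_self n))⟩

theorem atomicEquiv_prefixStructure {X Y : Type u} {sq sq' : X → ℕ → Y} {n : ℕ}
    {a b : Fin n → X} :
    AtomicEquiv (prefixStructure sq) (prefixStructure sq') n a b ↔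
      (∀ i j, a i = a j ↔ b i = b j) ∧
      ∀ i j m, Agree m (sq (a i)) (sq (a j)) ↔ Agree m (sq' (b i)) (sq' (b j)) := by
  rw [atomicEquiv_iff]
  constructor
  · rintro ⟨h1, h2⟩
    exact ⟨fun i j => h1 (.var i) (.var j), fun i j m => h2 2 (symE m) ![.var i, .var j]⟩
  · rintro ⟨h1, h2⟩
    refine ⟨fun s t => ?_, fun l R ts => ?_⟩
    · rcases s with i | f
      · rcases t with j | f
        · exact h1 i j
        · exact f.elim
      · exact f.elim
    · rcases R with ⟨m⟩
      have : ∀ t : refLanguage.Term (Fin n), ∃ i, t = .var i := by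
        rintro (i | f)
        · exact ⟨i, rfl⟩
        · exact f.elim
      obtain ⟨i, hi⟩ := this (ts 0)
      obtain ⟨j, hj⟩ := this (ts 1)
      refine (relMap_prefixStructure sq m _).trans
        (Iff.trans ?_ (relMap_prefixStructure sq' m _).symm)
      rw [hi, hj]
      exact h2 i j m

/-! ### Paths through the tree of finite tuples -/

/-- Finite tuples. -/
abbrev Node (X : Type u) : Type u := Σ n, Fin n → X

/-- A node of the tree of finite tuples, or the dead state `none`. -/
abbrev State (X : Type u) : Type u := Option (Node X)

/-- Stay, die, or append an element; the natural number distinguishes copies of a move. -/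
abbrev Move (X : Type u) : Type u := Option (Option X) × ℕ

/-- The effect of a move. -/
def State.step {X : Type u} : State X → Move X → State X
  | none, _ => none
  | some t, (none, _) => some t
  | some _, (some none, _) => none
  | some ⟨n, t⟩, (some (some a), _) => some ⟨n + 1, Fin.snoc t a⟩

/-- The state reached after `m` moves. -/
def run {X : Type u} (p : ℕ → Move X) : ℕ → State X
  | 0 => some ⟨0, Fin.elim0⟩
  | m + 1 => (run p m).step (p m)

theorem run_congr {X : Type u} {p q : ℕ → Move X} {m : ℕ} (h : Agree m p q) :
    run p m = run q m := by
  induction m with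
  | zero => rfl
  | succ m ih => rw [run, run, ih (h.mono (Nat.le_succ m)), h m (Nat.lt_succ_self m)]

theorem State.step_stay {X : Type u} (s : State X) (k : ℕ) : s.step (none, k) = s := by
  rcases s with _ | t <;> rfl

/-- From `n` on, the path stays. -/
def Rests {X : Type u} (n : ℕ) (p : ℕ → Move X) : Prop := ∀ i, n ≤ i → p i = (none, 0)

theorem Rests.run_eq {X : Type u} {n m : ℕ} {p : ℕ → Move X} (h : Rests n p) (hm : n ≤ m) :
    run p m = run p n := by
  induction m, hm using Nat.le_induction with
  | base => rfl
  | succ m hm ih => rw [run, h m hm, State.step_stay, ih]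

/-- The paths that eventually stay. -/
abbrev Path (X : Type u) : Type u := {p : ℕ → Move X // ∃ n, Rests n p}

/-- The final state of a path. -/
noncomputable def Path.final {X : Type u} (p : Path X) : State X := run p.1 p.2.choose

theorem Path.exists_run_eq_final {X : Type u} (p : Path X) (m : ℕ) :
    ∃ n, m ≤ n ∧ run p.1 n = p.final :=
  ⟨max m p.2.choose, le_max_left _ _, p.2.choose_spec.run_eq (le_max_right _ _)⟩

theorem Path.final_eq_run {X : Type u} (p : Path X) {n : ℕ} (h : Rests n p.1) :
    p.final = run p.1 n := by
  obtain ⟨m, hm, h'⟩ := p.exists_run_eq_final n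
  rw [← h', h.run_eq hm]

/-- Follow `p` below `n`, make the move `y`, and stay. -/
def branchAt {X : Type u} (p : ℕ → Move X) (n : ℕ) (y : Move X) : Path X :=
  ⟨fun i => if i < n then p i else if i = n then y else (none, 0), n + 1, fun i hi => by
    exact (if_neg (by omega)).trans (if_neg (by omega))⟩

theorem agree_branchAt {X : Type u} (p : ℕ → Move X) (n : ℕ) (y : Move X) :
    Agree n p (branchAt p n y).1 :=
  fun _ hi => (if_pos hi).symm

theorem branchAt_self {X : Type u} (p : ℕ → Move X) (n : ℕ) (y : Move X) :
    (branchAt p n y).1 n = y :=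
  (if_neg (lt_irrefl n)).trans (if_pos rfl)

theorem rests_branchAt {X : Type u} (p : ℕ → Move X) (n : ℕ) (y : Move X) :
    Rests (n + 1) (branchAt p n y).1 :=
  fun i hi => (if_neg (by omega)).trans (if_neg (by omega))

theorem run_branchAt {X : Type u} (p : ℕ → Move X) (n : ℕ) (y : Move X) :
    run (branchAt p n y).1 (n + 1) = (run p n).step y := by
  rw [run, branchAt_self, run_congr (agree_branchAt p n y)]

theorem final_branchAt {X : Type u} (p : ℕ → Move X) (n : ℕ) (y : Move X) :
    (branchAt p n y).final = (run p n).step y := by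
  rw [Path.final_eq_run _ (rests_branchAt p n y), run_branchAt]

/-- A path that dies at once. -/
def deadPath (X : Type u) : Path X := branchAt (fun _ => (none, 0)) 0 (some none, 0)

theorem final_deadPath (X : Type u) : (deadPath X).final = none := final_branchAt _ _ _

/-- An eventually resting path is determined by a finite list of moves, and there are only `#X` of
these. Hence the universe can be identified with pairs of a path and a counter. -/
theorem mk_path {X : Type u} [Infinite X] : #(Path X × ℕ) = #X := by
  have hY : #(Move X) = #X := by
    simp only [mk_prod, mk_option, mk_nat, lift_aleph0, lift_uzero]
    rw [add_one_eq (aleph0_le_mk X), add_one_eq (aleph0_le_mk X),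
      mul_aleph0_eq (aleph0_le_mk X)]
  have hP : #(Path X) = #X := by
    apply le_antisymm
    · have : Function.Surjective fun l : List (Move X) =>
          (⟨fun i => l.getD i (none, 0), l.length, fun i hi => List.getD_eq_default _ _ hi⟩ :
            Path X) := by
        rintro ⟨p, n, hn⟩
        refine ⟨List.ofFn fun i : Fin n => p i, Subtype.ext (funext fun i => ?_)⟩
        by_cases hi : i < n
        · simp [List.getD, hi]
        · simp [List.getD, hi, hn i (not_lt.1 hi)]
      refine (mk_le_of_surjective this).trans ?_
      rw [mk_list_eq_mk, hY]
    · refine mk_le_of_injective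
        (f := fun a : X => branchAt (fun _ => (none, 0)) 0 (some (some a), 0)) fun a b hab => ?_
      have := congrArg (fun p : Path X => p.1 0) hab
      simpa only [branchAt_self, Prod.mk.injEq, Option.some.injEq, and_true] using this
  rw [mk_prod, hP, mk_nat, lift_aleph0, lift_uzero, mul_aleph0_eq (aleph0_le_mk X)]

/-- An enumeration of the pairs of a path and a natural number. -/
noncomputable def pathEquiv (X : Type u) [Infinite X] : X ≃ Path X × ℕ :=
  (Cardinal.eq.1 (mk_path (X := X))).some.symm

/-! ### The model attached to a colouring of the finite tuples -/

/-- The path attached to a pair: only `c t` of the pairs that belong to a path with the final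
state `t` are attached to this path. -/
noncomputable def codePath {X : Type u} (c : Node X → ℕ) (x : Path X × ℕ) : Path X :=
  match x.1.final with
  | none => x.1
  | some t => if x.2 < c t then x.1 else deadPath X

/-- The path attached to an element. -/
noncomputable def pathOf {X : Type u} [Infinite X] (c : Node X → ℕ) (x : X) : ℕ → Move X :=
  (codePath c (pathEquiv X x)).1

/-- The number of elements attached to a path with the given final state. -/
def State.weight {X : Type u} (c : Node X → ℕ) : State X → ℕ∞
  | none => ⊤
  | some t => c t

/-- The colouring by natural numbers is given by a binary labelling of the tree of tuples:
the colour of a tuple is the number whose binary digits are `1` and the labels along the tuple. -/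
structure IsBinaryColouring {X : Type u} (c : Node X → ℕ) : Prop where
  root : ∀ t, c ⟨0, t⟩ = 1
  child : ∀ n (t : Fin n → X) a, c ⟨n + 1, Fin.snoc t a⟩ = 2 * c ⟨n, t⟩ ∨
    c ⟨n + 1, Fin.snoc t a⟩ = 2 * c ⟨n, t⟩ + 1

theorem IsBinaryColouring.pos {X : Type u} {c : Node X → ℕ} (hc : IsBinaryColouring c) (t : Node X) :
    0 < c t := by
  obtain ⟨n, t⟩ := t
  induction n with
  | zero => rw [hc.root]; exact one_pos
  | succ n ih =>
    have := hc.child n (Fin.init t) (t (Fin.last n))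
    rw [Fin.snoc_init_self] at this
    have := ih (Fin.init t)
    omega

/-- A path ending at a tuple `t` keeps the pairs with counter below `c t`, and receives no others
because surplus pairs go to a dead path. A dead path keeps its pairs for all counters, so surplus
pairs do not affect its infinite size. -/
theorem encard_pathOf {X : Type u} [Infinite X] (c : Node X → ℕ) (p : Path X) :
    {x | pathOf c x = p.1}.encard = p.final.weight c := by
  have h1 : {x | pathOf c x = p.1} = (pathEquiv X).symm '' {y | codePath c y = p} := by
    rw [Equiv.image_symm_eq_preimage]
    ext x
    exact Subtype.ext_iff.symm
  rw [h1, (pathEquiv X).symm.injective.encard_image]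
  rcases hp : p.final with _ | t
  · refine Set.encard_eq_top (Set.infinite_of_injective_forall_mem
      (f := fun i : ℕ => (p, i)) (fun i j h => (Prod.ext_iff.1 h).2) fun i => ?_)
    simp only [Set.mem_ofPred_eq, codePath, hp]
  · have h2 : {y | codePath c y = p} = (fun i : ℕ => (p, i)) '' Set.Iio (c t) := by
      ext ⟨q, i⟩
      simp only [Set.mem_ofPred_eq, Set.mem_image, Set.mem_Iio, Prod.mk.injEq, codePath]
      constructor
      · intro h
        rcases hq : q.final with _ | t'
        · rw [hq] at h
          subst h
          rw [hq] at hp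
          exact absurd hp (by simp)
        · rw [hq] at h
          dsimp only at h
          split_ifs at h with hi
          · subst h
            rw [hq] at hp
            cases hp
            exact ⟨i, hi, rfl, rfl⟩
          · rw [← h, final_deadPath] at hp
            exact absurd hp (by simp)
      · rintro ⟨j, hj, rfl, rfl⟩
        rw [hp]
        exact if_pos hj
    rw [h2, Function.Injective.encard_image fun i j h => (Prod.ext_iff.1 h).2]
    rw [← Finset.coe_Iio, Set.encard_coe_eq_coe_finsetCard, Nat.card_Iio, State.weight]

theorem exists_pathOf_eq {X : Type u} [Infinite X] {c : Node X → ℕ} (hc : IsBinaryColouring c)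
    (p : Path X) : ∃ x, pathOf c x = p.1 := by
  have h : {x | pathOf c x = p.1}.encard ≠ 0 := by
    rw [encard_pathOf]
    rcases p.final with _ | t
    · exact ENat.top_ne_zero
    · exact Nat.cast_ne_zero.2 (hc.pos t).ne'
  exact Set.encard_ne_zero.1 h

/-- Infinite splitting comes from following the given path for `n` moves and then using different
copies of the staying move. Positivity of the colours ensures that each resulting path is occupied.
-/
theorem holds_refInf_pathOf {X : Type u} [Infinite X] {c : Node X → ℕ} (hc : IsBinaryColouring c) :
    @InfSentence.Holds _ _ refInf X (prefixStructure (pathOf c)) := by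
  refine holds_refInf_prefixStructure _ fun a n k => ?_
  choose b hb using fun i : Fin k => exists_pathOf_eq hc (branchAt (pathOf c a) n (none, i))
  refine ⟨b, fun i => ?_, fun i j hij h => hij ?_⟩
  · rw [hb]
    exact agree_branchAt _ _ _
  · rw [hb, hb, branchAt_self, branchAt_self] at h
    exact Fin.ext (Prod.ext_iff.1 h).2

/-- Tuples of the same colour. -/
def SameColour {X : Type u} (c c' : Node X → ℕ) (n : ℕ) (s t : Fin n → X) : Prop :=
  c ⟨n, s⟩ = c' ⟨n, t⟩

/-! ### From back-and-forth systems between tuples to back-and-forth systems between models -/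

/-- States that are both dead or consist of related tuples. -/
inductive StateRel {X : Type u} (B : ∀ n, (Fin n → X) → (Fin n → X) → Prop) :
    State X → State X → Prop
  | dead : StateRel B none none
  | node {n : ℕ} {s t : Fin n → X} (h : B n s t) : StateRel B (some ⟨n, s⟩) (some ⟨n, t⟩)

section Forward

variable {X : Type u} {c c' : Node X → ℕ} {B : ∀ n, (Fin n → X) → (Fin n → X) → Prop}

theorem StateRel.symm {s t : State X} (h : StateRel B s t) :
    StateRel (fun n b a => B n a b) t s := by
  rcases h with _ | h
  · exact .dead
  · exact .node h

theorem StateRel.weight_eq (hB : IsBackForth (SameColour c c') B) {s t : State X}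
    (h : StateRel B s t) : s.weight c = t.weight c' := by
  rcases h with _ | h
  · rfl
  · exact congrArg Nat.cast (hB.sub h)

/-- The matching move is dictated up to its label by `hB.forth`; infinitely many labels are
available, so a finite set can be avoided. -/
theorem StateRel.exists_step (hB : IsBackForth (SameColour c c') B) {s t : State X}
    (h : StateRel B s t) (y : Move X) {F : Set (Move X)} (hF : F.Finite) :
    ∃ z ∉ F, StateRel B (s.step y) (t.step z) := by
  have fresh : ∀ o, ∃ k : ℕ, (o, k) ∉ F := by
    intro o
    obtain ⟨k, hk⟩ := (hF.preimage (f := fun k : ℕ => (o, k))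
      fun i _ j _ hij => (Prod.ext_iff.1 hij).2).exists_notMem
    exact ⟨k, hk⟩
  rcases h with _ | @⟨n, s, t, h⟩
  · obtain ⟨k, hk⟩ := fresh none
    exact ⟨_, hk, .dead⟩
  · rcases y with ⟨_ | _ | a, i⟩
    · obtain ⟨k, hk⟩ := fresh none
      exact ⟨_, hk, .node h⟩
    · obtain ⟨k, hk⟩ := fresh (some none)
      exact ⟨_, hk, .dead⟩
    · obtain ⟨b, hb⟩ := hB.forth h a
      obtain ⟨k, hk⟩ := fresh (some (some b))
      exact ⟨_, hk, .node hb⟩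

/-- A path with related states, except in the part already given, and with a fresh `n`-th move. -/
theorem exists_path_stateRel (hB : IsBackForth (SameColour c c') B) {p q : ℕ → Move X} {n : ℕ}
    (hp : ∃ N, Rests N p) (h : ∀ m ≤ n, StateRel B (run p m) (run q m)) {F : Set (Move X)}
    (hF : F.Finite) :
    ∃ r : Path X, Agree n q r.1 ∧ r.1 n ∉ F ∧ ∀ m, StateRel B (run p m) (run r.1 m) := by
  have key : ∀ {q : ℕ → Move X} {n : ℕ} (_ : ∀ m ≤ n, StateRel B (run p m) (run q m))
      {F : Set (Move X)} (_ : F.Finite), ∃ r : Path X, Agree n q r.1 ∧ r.1 n ∉ F ∧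
        Rests (n + 1) r.1 ∧ ∀ m ≤ n + 1, StateRel B (run p m) (run r.1 m) := by
    intro q n h F hF
    obtain ⟨z, hz, hstep⟩ := (h n le_rfl).exists_step hB (p n) hF
    refine ⟨branchAt q n z, agree_branchAt q n z, by rwa [branchAt_self], rests_branchAt q n z,
      fun m hm => ?_⟩
    rcases Nat.le_succ_iff.1 hm with hm | rfl
    · rw [← run_congr ((agree_branchAt q n z).mono hm)]
      exact h m hm
    · rwa [run_branchAt]
  have iter : ∀ k, ∃ r : Path X, Agree n q r.1 ∧ r.1 n ∉ F ∧ Rests (n + 1 + k) r.1 ∧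
      ∀ m ≤ n + 1 + k, StateRel B (run p m) (run r.1 m) := by
    intro k
    induction k with
    | zero => exact key h hF
    | succ k ih =>
      obtain ⟨r, h1, h2, -, h4⟩ := ih
      obtain ⟨r', h1', -, h3', h4'⟩ := key h4 (F := ∅) Set.finite_empty
      refine ⟨r', h1.trans (h1'.mono (by omega)), ?_, h3', h4'⟩
      rwa [← h1' n (by omega)]
  -- After level `n + 1 + N` both paths rest, so finitely many matching moves settle all later
  -- levels.
  obtain ⟨N, hN⟩ := hp
  obtain ⟨r, h1, h2, h3, h4⟩ := iter N
  refine ⟨r, h1, h2, fun m => ?_⟩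
  rcases le_total m (n + 1 + N) with hm | hm
  · exact h4 m hm
  · rw [h3.run_eq hm, hN.run_eq (le_trans (by omega) hm), ← hN.run_eq (m := n + 1 + N) (by omega)]
    exact h4 _ le_rfl

/-- Tuples of elements with the same pattern of equality and agreement, and with related states. -/
structure PatternRel [Infinite X] (c c' : Node X → ℕ)
    (B : ∀ n, (Fin n → X) → (Fin n → X) → Prop) (k : ℕ) (a b : Fin k → X) : Prop where
  eq_iff : ∀ i j, a i = a j ↔ b i = b j
  agree_iff : ∀ i j m, Agree m (pathOf c (a i)) (pathOf c (a j)) ↔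
    Agree m (pathOf c' (b i)) (pathOf c' (b j))
  state : ∀ i m, StateRel B (run (pathOf c (a i)) m) (run (pathOf c' (b i)) m)

theorem PatternRel.symm [Infinite X] {k : ℕ} {a b : Fin k → X} (h : PatternRel c c' B k a b) :
    PatternRel c' c (fun n b a => B n a b) k b a :=
  ⟨fun i j => (h.eq_iff i j).symm, fun i j m => (h.agree_iff i j m).symm,
    fun i m => (h.state i m).symm⟩

theorem PatternRel.snoc [Infinite X] {k : ℕ} {a b : Fin k → X} (h : PatternRel c c' B k a b)
    {x y : X} (heq : ∀ j, a j = x ↔ b j = y)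
    (hag : ∀ j m, Agree m (pathOf c (a j)) (pathOf c x) ↔ Agree m (pathOf c' (b j)) (pathOf c' y))
    (hst : ∀ m, StateRel B (run (pathOf c x) m) (run (pathOf c' y) m)) :
    PatternRel c c' B (k + 1) (Fin.snoc a x : Fin (k + 1) → X) (Fin.snoc b y : Fin (k + 1) → X) := by
  refine ⟨fun i j => ?_, fun i j m => ?_, fun i m => ?_⟩
  · induction i using Fin.lastCases with
    | last =>
      induction j using Fin.lastCases with
      | last => simp
      | cast j => simpa [eq_comm] using heq j
    | cast i =>
      induction j using Fin.lastCases with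
      | last => simpa using heq i
      | cast j => simpa using h.eq_iff i j
  · induction i using Fin.lastCases with
    | last =>
      induction j using Fin.lastCases with
      | last => simp [Agree]
      | cast j => simpa [Agree, eq_comm] using hag j m
    | cast i =>
      induction j using Fin.lastCases with
      | last => simpa using hag i m
      | cast j => simpa using h.agree_iff i j m
  · induction i using Fin.lastCases with
    | last => simpa using hst m
    | cast i => simpa using h.state i m

theorem agree_all_iff {Y : Type u} {p q : ℕ → Y} : (∀ m, Agree m p q) ↔ p = q :=
  ⟨fun h => funext fun i => h (i + 1) i (Nat.lt_succ_self i), fun h _ _ _ => h ▸ rfl⟩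

/-- Both sizes are the weights of the final states; these are compared at a level from which both
paths rest. -/
theorem PatternRel.encard_eq [Infinite X] (hB : IsBackForth (SameColour c c') B) {k : ℕ}
    {a b : Fin k → X} (h : PatternRel c c' B k a b) (i : Fin k) :
    {x | pathOf c x = pathOf c (a i)}.encard = {x | pathOf c' x = pathOf c' (b i)}.encard := by
  have h1 := encard_pathOf c (codePath c (pathEquiv X (a i)))
  have h2 := encard_pathOf c' (codePath c' (pathEquiv X (b i)))
  refine h1.trans (Eq.trans ?_ h2.symm)
  obtain ⟨m, hm⟩ := (codePath c (pathEquiv X (a i))).2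
  obtain ⟨n, hn⟩ := (codePath c' (pathEquiv X (b i))).2
  rw [Path.final_eq_run _ hm, Path.final_eq_run _ hn, ← hm.run_eq (le_max_left m n),
    ← hn.run_eq (le_max_right m n)]
  exact (h.state i (max m n)).weight_eq hB

/-- If the element `x` is new but its path is not, there is a matching new element. -/
theorem PatternRel.exists_new_of_path_eq [Infinite X] (hB : IsBackForth (SameColour c c') B)
    {k : ℕ} {a b : Fin k → X} (h : PatternRel c c' B k a b) {x : X} {i : Fin k}
    (hx : pathOf c (a i) = pathOf c x) (hne : ∀ j, a j ≠ x) :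
    ∃ y, pathOf c' (b i) = pathOf c' y ∧ ∀ j, b j ≠ y := by
  by_contra! H
  let s : Set X := {z | pathOf c z = pathOf c (a i)}
  let s' : Set X := {z | pathOf c' z = pathOf c' (b i)}
  let I : Set (Fin k) := {j | pathOf c (a j) = pathOf c (a i)}
  have hI : ∀ j, pathOf c' (b j) = pathOf c' (b i) → j ∈ I := fun j hj =>
    agree_all_iff.1 fun m => (h.agree_iff j i m).2 (agree_all_iff.2 hj m)
  have hs' : s' ⊆ b '' I := by
    intro y hy
    obtain ⟨j, hj⟩ := H y hy.symm
    exact ⟨j, hI j (by rw [hj]; exact hy), hj⟩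
  have hfac : b.FactorsThrough a := fun j l hjl => (h.eq_iff j l).1 hjl
  have hb : b '' I = Function.extend a b id '' (a '' I) := by
    rw [← Set.image_comp]
    exact Set.image_congr fun j _ => (hfac.extend_apply id j).symm
  have hle : s.encard ≤ (a '' I).encard :=
    calc s.encard = s'.encard := h.encard_eq hB i
      _ ≤ (b '' I).encard := Set.encard_le_encard hs'
      _ ≤ (a '' I).encard := by rw [hb]; exact Set.encard_image_le _ _
  have hsub : a '' I ⊆ s := by
    rintro _ ⟨j, hj, rfl⟩
    exact hj
  -- If every element on the matching path were already used, that path would be finite and the size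
  -- comparison would force `a` to exhaust the path of `x` as well.
  have heq := (Set.toFinite (a '' I)).eq_of_subset_of_encard_le hsub hle
  have hxs : x ∈ s := hx.symm
  rw [← heq] at hxs
  obtain ⟨j, -, hj⟩ := hxs
  exact hne j hj

/-- If the path of `x` is new, there is an element with a matching new path. -/
theorem PatternRel.exists_new_of_path_ne [Infinite X] (hc' : IsBinaryColouring c')
    (hB : IsBackForth (SameColour c c') B) (h0 : B 0 Fin.elim0 Fin.elim0) {k : ℕ}
    {a b : Fin k → X} (h : PatternRel c c' B k a b) {x : X}
    (hx : ∀ i, pathOf c (a i) ≠ pathOf c x) :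
    ∃ y, (∀ j m, Agree m (pathOf c (a j)) (pathOf c x) ↔
        Agree m (pathOf c' (b j)) (pathOf c' y)) ∧
      ∀ m, StateRel B (run (pathOf c x) m) (run (pathOf c' y) m) := by
  classical
  have hex : ∃ N, ∀ i, ¬ Agree (N + 1) (pathOf c (a i)) (pathOf c x) := by
    have : ∀ i, ∃ m, ¬ Agree m (pathOf c (a i)) (pathOf c x) := by
      intro i
      by_contra! H
      exact hx i (agree_all_iff.1 H)
    choose d hd using this
    obtain ⟨N, hN⟩ := (Set.finite_range d).bddAbove
    exact ⟨N, fun i hi => hd i (hi.mono ((hN ⟨i, rfl⟩).trans (Nat.le_succ N)))⟩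
  -- Minimality makes `N` the greatest length of agreement between the path of `x` and the paths
  -- already present, or `0` if there are none.
  obtain ⟨N, hN, hmin⟩ : ∃ N, (∀ i, ¬ Agree (N + 1) (pathOf c (a i)) (pathOf c x)) ∧
      ∀ M, N = M + 1 → ∃ i, Agree N (pathOf c (a i)) (pathOf c x) := by
    refine ⟨Nat.find hex, Nat.find_spec hex, fun M hM => ?_⟩
    have := Nat.find_min hex (m := M) (by omega)
    push Not at this
    rwa [← hM] at this
  -- `q` supplies the prefix of length `N`, copied from the partner of a path that agrees longest
  -- with that of `x`. For `N = 0` any sequence will do. The move at level `N` must then differ from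
  -- those of all the `b j`.
  obtain ⟨q, hq, hqb⟩ : ∃ q : ℕ → Move X,
      (∀ m ≤ N, StateRel B (run (pathOf c x) m) (run q m)) ∧
      ∀ j, ∀ m ≤ N, Agree m (pathOf c (a j)) (pathOf c x) ↔ Agree m (pathOf c' (b j)) q := by
    rcases N with _ | M
    · refine ⟨fun _ => (none, 0), fun m hm => ?_, fun j m hm => ?_⟩
      · rw [Nat.le_zero.1 hm]
        exact .node h0
      · rw [Nat.le_zero.1 hm]
        exact iff_of_true (fun i hi => absurd hi (Nat.not_lt_zero i))
          fun i hi => absurd hi (Nat.not_lt_zero i)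
    · obtain ⟨i, hi⟩ := hmin M rfl
      refine ⟨pathOf c' (b i), fun m hm => ?_, fun j m hm => ?_⟩
      · rw [← run_congr (hi.mono hm)]
        exact h.state i m
      · rw [← h.agree_iff j i m]
        exact ⟨fun H => H.trans (hi.mono hm).symm, fun H => H.trans (hi.mono hm)⟩
  obtain ⟨r, hr1, hr2, hr3⟩ := exists_path_stateRel hB (codePath c (pathEquiv X x)).2 hq
    (Set.finite_range fun j => pathOf c' (b j) N)
  obtain ⟨y, hy⟩ := exists_pathOf_eq hc' r
  refine ⟨y, fun j m => ?_, fun m => by rw [hy]; exact hr3 m⟩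
  rw [hy]
  rcases le_or_gt m N with hm | hm
  · rw [hqb j m hm]
    exact ⟨fun H => H.trans (hr1.mono hm), fun H => H.trans (hr1.mono hm).symm⟩
  · refine iff_of_false (fun H => hN j (H.mono hm)) fun H => hr2 ⟨j, ?_⟩
    exact H N hm

theorem PatternRel.exists_snoc [Infinite X] (hc' : IsBinaryColouring c')
    (hB : IsBackForth (SameColour c c') B) (h0 : B 0 Fin.elim0 Fin.elim0) {k : ℕ}
    {a b : Fin k → X} (h : PatternRel c c' B k a b) (x : X) :
    ∃ y, PatternRel c c' B (k + 1) (Fin.snoc a x : Fin (k + 1) → X)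
      (Fin.snoc b y : Fin (k + 1) → X) := by
  by_cases hx : ∃ i, pathOf c (a i) = pathOf c x
  · obtain ⟨i, hi⟩ := hx
    by_cases hxa : ∃ j, a j = x
    · obtain ⟨j, rfl⟩ := hxa
      exact ⟨b j, h.snoc (fun l => h.eq_iff l j) (fun l m => h.agree_iff l j m) (h.state j)⟩
    · push Not at hxa
      obtain ⟨y, hy, hyb⟩ := h.exists_new_of_path_eq hB hi hxa
      refine ⟨y, h.snoc (fun l => iff_of_false (hxa l) (hyb l)) (fun l m => ?_) fun m => ?_⟩
      · rw [← hi, ← hy]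
        exact h.agree_iff l i m
      · rw [← hi, ← hy]
        exact h.state i m
  · push Not at hx
    obtain ⟨y, hy, hst⟩ := h.exists_new_of_path_ne hc' hB h0 hx
    refine ⟨y, h.snoc (fun l => iff_of_false (fun H => hx l (H ▸ rfl)) fun H => hx l ?_) hy hst⟩
    exact agree_all_iff.1 fun m => (hy l m).2 (H ▸ fun _ _ => rfl)

theorem backForth_pathOf [Infinite X] (hc : IsBinaryColouring c) (hc' : IsBinaryColouring c')
    (h : BackForth (SameColour c c')) :
    BackForth (AtomicEquiv (prefixStructure (pathOf c)) (prefixStructure (pathOf c'))) := by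
  obtain ⟨B, hB, h0⟩ := h
  refine ⟨PatternRel c c' B, ⟨fun H => atomicEquiv_prefixStructure.2 ⟨H.eq_iff, H.agree_iff⟩,
    fun H x => H.exists_snoc hc' hB h0 x, fun H y => ?_⟩,
    ⟨fun i => i.elim0, fun i => i.elim0, fun i => i.elim0⟩⟩
  obtain ⟨x, hx⟩ := H.symm.exists_snoc hc (B := fun n b a => B n a b)
    ⟨fun H' => (hB.sub H').symm, hB.back, hB.forth⟩ h0 y
  exact ⟨x, hx.symm⟩

end Forward

/-! ### From back-and-forth systems between models to back-and-forth systems between tuples -/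

section Backward

variable {X : Type u} {c c' : Node X → ℕ}
  {B : ∀ n, (Fin n → X) → (Fin n → X) → Prop}

theorem IsBinaryColouring.weight_le_step (hc : IsBinaryColouring c) (s : State X) (y : Move X) :
    s.weight c ≤ (s.step y).weight c := by
  rcases s with _ | ⟨n, t⟩
  · exact le_rfl
  · rcases y with ⟨_ | _ | a, i⟩
    · exact le_rfl
    · exact le_top
    · have := hc.child n t a
      exact Nat.cast_le.2 (by omega)

theorem IsBinaryColouring.weight_run_le (hc : IsBinaryColouring c) (p : ℕ → Move X) {m n : ℕ}
    (hmn : m ≤ n) : (run p m).weight c ≤ (run p n).weight c := by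
  induction n, hmn using Nat.le_induction with
  | base => exact le_rfl
  | succ n _ ih => exact ih.trans (hc.weight_le_step _ _)

/-- Adjoin `k` distinct elements of the path of `a i` to the tuple. Their partners are distinct and
agree with `b i` to every length, hence lie on its path. -/
theorem encard_path_le [Infinite X] (hB : IsBackForth
    (AtomicEquiv (prefixStructure (pathOf c)) (prefixStructure (pathOf c'))) B) {n : ℕ}
    {a b : Fin n → X} (h : B n a b) (i : Fin n) :
    {x | pathOf c x = pathOf c (a i)}.encard ≤ {x | pathOf c' x = pathOf c' (b i)}.encard := by
  refine ENat.forall_natCast_le_iff_le.1 fun k hk => ?_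
  obtain ⟨s, hs, hsk⟩ := Set.exists_subset_encard_eq hk
  have hfin : s.Finite := Set.finite_of_encard_eq_coe hsk
  have := hfin.to_subtype
  have hcard : s.ncard = k := by rw [Set.ncard, hsk, ENat.toNat_natCast]
  let z : Fin k ≃ s := (Finite.equivFinOfCardEq (by rw [← hcard]; rfl)).symm
  obtain ⟨a', b', hB', ha, hb, hz⟩ := hB.extend h k fun j => (z j : X)
  obtain ⟨h1, h2⟩ := atomicEquiv_prefixStructure.1 (hB.sub hB')
  have hinj : Function.Injective fun j => b' (Fin.natAdd n j) := by
    intro j l hjl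
    have := (h1 _ _).2 hjl
    rw [hz, hz] at this
    exact z.injective (Subtype.ext this)
  have hsub : Set.range (fun j => b' (Fin.natAdd n j)) ⊆
      {x | pathOf c' x = pathOf c' (b i)} := by
    rintro _ ⟨j, rfl⟩
    refine agree_all_iff.1 fun m => ?_
    rw [← hb, ← h2, ha, hz]
    exact agree_all_iff.2 (hs (z j).2) m
  refine le_trans (le_of_eq ?_) (Set.encard_le_encard hsub)
  rw [← Set.image_univ, hinj.encard_image, Set.encard_univ]
  simp

theorem encard_path_eq [Infinite X] (hB : IsBackForth
    (AtomicEquiv (prefixStructure (pathOf c)) (prefixStructure (pathOf c'))) B) {n : ℕ}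
    {a b : Fin n → X} (h : B n a b) (i : Fin n) :
    {x | pathOf c x = pathOf c (a i)}.encard = {x | pathOf c' x = pathOf c' (b i)}.encard := by
  refine le_antisymm (encard_path_le hB h i) (encard_path_le (c := c') (c' := c)
    (B := fun n b a => B n a b) ⟨fun H => ?_, hB.back, hB.forth⟩ h i)
  exact fun θ hθ => (hB.sub H θ hθ).symm

theorem encard_pathOf_self [Infinite X] (c : Node X → ℕ) (x : X) (m : ℕ) :
    ∃ n, m ≤ n ∧ {z | pathOf c z = pathOf c x}.encard = (run (pathOf c x) n).weight c := by
  obtain ⟨n, hmn, hn⟩ := (codePath c (pathEquiv X x)).exists_run_eq_final m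
  exact ⟨n, hmn, (encard_pathOf c _).trans (congrArg _ hn.symm)⟩

/-- Take `x` that follows `a i` for `m` moves and then rests: the size of its path is the weight at
level `m`. Its partner `y` follows `b i` for `m` moves, and the equal size of its path is at least
the weight there, since weights never decrease along a run. -/
theorem weight_run_le_of_backForth [Infinite X] (hc : IsBinaryColouring c)
    (hc' : IsBinaryColouring c') (hB : IsBackForth
      (AtomicEquiv (prefixStructure (pathOf c)) (prefixStructure (pathOf c'))) B) {n : ℕ}
    {a b : Fin n → X} (h : B n a b) (i : Fin n) (m : ℕ) :
    (run (pathOf c' (b i)) m).weight c' ≤ (run (pathOf c (a i)) m).weight c := by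
  obtain ⟨x, hx⟩ := exists_pathOf_eq hc (branchAt (pathOf c (a i)) m (none, 0))
  obtain ⟨y, hy⟩ := hB.forth h x
  have henc := encard_path_eq hB hy (Fin.last n)
  have hag := ((atomicEquiv_prefixStructure.1 (hB.sub hy)).2 i.castSucc (Fin.last n) m).1
  simp only [Fin.snoc_last, Fin.snoc_castSucc] at henc hag
  rw [hx, encard_pathOf, final_branchAt, State.step_stay] at henc
  obtain ⟨l, hml, hl⟩ := encard_pathOf_self c' y m
  rw [run_congr (hag (hx ▸ agree_branchAt _ _ _)), henc, hl]
  exact hc'.weight_run_le _ hml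

theorem weight_run_eq_of_backForth [Infinite X] (hc : IsBinaryColouring c)
    (hc' : IsBinaryColouring c') (hB : IsBackForth
      (AtomicEquiv (prefixStructure (pathOf c)) (prefixStructure (pathOf c'))) B) {n : ℕ}
    {a b : Fin n → X} (h : B n a b) (i : Fin n) (m : ℕ) :
    (run (pathOf c (a i)) m).weight c = (run (pathOf c' (b i)) m).weight c' :=
  le_antisymm (weight_run_le_of_backForth (B := fun n b a => B n a b) hc' hc
    ⟨fun H θ hθ => (hB.sub H θ hθ).symm, hB.back, hB.forth⟩ h i m)
    (weight_run_le_of_backForth hc hc' hB h i m)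

/-- Tuples reached at the same level by related elements. -/
def ReachRel [Infinite X] (c c' : Node X → ℕ) (B : ∀ n, (Fin n → X) → (Fin n → X) → Prop) (n : ℕ)
    (s t : Fin n → X) : Prop :=
  ∃ (k : ℕ) (a b : Fin k → X) (i : Fin k) (m : ℕ), B k a b ∧
    run (pathOf c (a i)) m = some ⟨n, s⟩ ∧ run (pathOf c' (b i)) m = some ⟨n, t⟩

/-- The partner of a path that appends `x` must have the child's colour at level `m + 1`. Staying
would leave the smaller parent colour, and dying would give `⊤`, so the partner appends some `y`. -/
theorem ReachRel.exists_snoc [Infinite X] (hc : IsBinaryColouring c)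
    (hc' : IsBinaryColouring c') (hB : IsBackForth
      (AtomicEquiv (prefixStructure (pathOf c)) (prefixStructure (pathOf c'))) B) {n : ℕ}
    {s t : Fin n → X} (h : ReachRel c c' B n s t) (x : X) :
    ∃ y, ReachRel c c' B (n + 1) (Fin.snoc s x) (Fin.snoc t y) := by
  obtain ⟨k, a, b, i, m, hab, ha, hb⟩ := h
  obtain ⟨z, hz⟩ := exists_pathOf_eq hc (branchAt (pathOf c (a i)) m (some (some x), 0))
  obtain ⟨w, hw⟩ := hB.forth hab z
  have hag := ((atomicEquiv_prefixStructure.1 (hB.sub hw)).2 i.castSucc (Fin.last k) m).1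
  have hwt := weight_run_eq_of_backForth hc hc' hB hw (Fin.last k) (m + 1)
  have hst := weight_run_eq_of_backForth hc hc' hB hab i m
  simp only [Fin.snoc_last, Fin.snoc_castSucc] at hag hwt
  have hzrun : run (pathOf c z) (m + 1) = some ⟨n + 1, Fin.snoc s x⟩ := by
    rw [hz, run_branchAt, ha, State.step]
  have hwrun : run (pathOf c' w) m = some ⟨n, t⟩ := by
    rw [← hb]
    exact (run_congr (hag (hz ▸ agree_branchAt _ _ _))).symm
  have hchild := hc.child n s x
  have hpos := hc.pos ⟨n, s⟩
  rw [ha, hb] at hst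
  have hst' : c ⟨n, s⟩ = c' ⟨n, t⟩ := Nat.cast_injective (R := ℕ∞) hst
  rw [hzrun] at hwt
  have hnext : ∃ y, run (pathOf c' w) (m + 1) = some ⟨n + 1, Fin.snoc t y⟩ := by
    rw [run, hwrun] at hwt ⊢
    generalize pathOf c' w m = move at hwt ⊢
    rcases move with ⟨_ | _ | y, j⟩
    · have : c ⟨n + 1, Fin.snoc s x⟩ = c' ⟨n, t⟩ := Nat.cast_injective (R := ℕ∞) hwt
      omega
    · exact absurd hwt (ENat.natCast_ne_top _)
    · exact ⟨y, rfl⟩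
  obtain ⟨y, hy⟩ := hnext
  refine ⟨y, k + 1, _, _, Fin.last k, m + 1, hw, ?_, ?_⟩
  · rwa [Fin.snoc_last]
  · rwa [Fin.snoc_last]

theorem backForth_sameColour [Infinite X] (hc : IsBinaryColouring c) (hc' : IsBinaryColouring c')
    (h : BackForth (AtomicEquiv (prefixStructure (pathOf c)) (prefixStructure (pathOf c')))) :
    BackForth (SameColour c c') := by
  obtain ⟨B, hB, h0⟩ := h
  refine ⟨ReachRel c c' B, ⟨?_, fun H x => H.exists_snoc hc hc' hB x, ?_⟩, ?_⟩
  · rintro n s t ⟨k, a, b, i, m, hab, ha, hb⟩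
    have := weight_run_eq_of_backForth hc hc' hB hab i m
    rw [ha, hb] at this
    exact Nat.cast_injective (R := ℕ∞) this
  · rintro n s t ⟨k, a, b, i, m, hab, ha, hb⟩ y
    obtain ⟨x, k, b, a, i, m, hab, hb, ha⟩ :=
      ReachRel.exists_snoc hc' hc (B := fun n b a => B n a b)
        ⟨fun H θ hθ => (hB.sub H θ hθ).symm, hB.back, hB.forth⟩ ⟨k, b, a, i, m, hab, hb, ha⟩ y
    exact ⟨x, k, a, b, i, m, hab, ha, hb⟩
  -- The empty tuple has no component to run along. Any related pair of elements is at the root at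
  -- level `0`.
  · obtain ⟨y, hy⟩ := hB.forth h0 (Classical.arbitrary X)
    exact ⟨1, _, _, 0, 0, hy, rfl, rfl⟩

end Backward

theorem backForth_pathOf_iff {X : Type u} [Infinite X] {c c' : Node X → ℕ}
    (hc : IsBinaryColouring c) (hc' : IsBinaryColouring c') :
    BackForth (SameColour c c') ↔
      BackForth (AtomicEquiv (prefixStructure (pathOf c)) (prefixStructure (pathOf c'))) :=
  ⟨backForth_pathOf hc hc', backForth_sameColour hc hc'⟩

/-! ### The colouring attached to a structure -/

/-- Atomic formulas with an arbitrary finite number of free variables. -/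
abbrev AtomicFormula (L : FirstOrder.Language.{0, 0}) : Type :=
  Σ k, {θ : L.Formula (Fin k) // θ.IsAtomic}

section Colour

variable {L : FirstOrder.Language.{0, 0}} {X : Type u}

/-- The tuple satisfies the formula, which has no variables outside the tuple. -/
def TupleRealize (S : L.Structure X) (θ : AtomicFormula L) {n : ℕ} (t : Fin n → X) : Prop :=
  ∃ h : θ.1 ≤ n, θ.2.1.Realize fun i => t (Fin.castLE h i)

open Classical in
/-- The colour of a tuple records the truth of the first formulas of a list of atomic formulas,
the `n`-th one for the initial segment of length `n + 1`. -/
noncomputable def colour (enum : ℕ → AtomicFormula L) (S : L.Structure X) :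
    ∀ n, (Fin n → X) → ℕ
  | 0, _ => 1
  | n + 1, t => 2 * colour enum S n (Fin.init t) + if TupleRealize S (enum n) t then 1 else 0

/-- The colouring of all tuples of a structure. -/
noncomputable def colouring (enum : ℕ → AtomicFormula L) (S : L.Structure X) (t : Node X) : ℕ :=
  colour enum S t.1 t.2

theorem isBinaryColouring_colouring (enum : ℕ → AtomicFormula L) (S : L.Structure X) :
    IsBinaryColouring (colouring enum S) := by
  refine ⟨fun t => rfl, fun n t a => ?_⟩
  simp only [colouring, colour, Fin.init_snoc]
  split_ifs
  · exact Or.inr rfl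
  · exact Or.inl rfl

theorem colour_eq_of_atomicEquiv (enum : ℕ → AtomicFormula L) {S S' : L.Structure X} {n : ℕ}
    {s t : Fin n → X} (h : AtomicEquiv S S' n s t) :
    colour enum S n s = colour enum S' n t := by
  classical
  induction n with
  | zero => rfl
  | succ n ih =>
    have h1 : TupleRealize S (enum n) s ↔ TupleRealize S' (enum n) t :=
      exists_congr fun hk => h.comp (Fin.castLE hk) _ (enum n).2.2
    simp only [colour]
    rw [ih (s := Fin.init s) (t := Fin.init t) (h.comp Fin.castSucc)]
    exact congrArg _ (if_congr h1 rfl rfl)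

/-- Structures are back-and-forth equivalent if and only if their coloured trees of tuples are. -/
theorem backForth_colouring_iff {enum : ℕ → AtomicFormula L}
    (henum : ∀ θ n, ∃ m, n ≤ m ∧ enum m = θ) [Nonempty X] {S S' : L.Structure X} :
    BackForth (AtomicEquiv S S') ↔ BackForth (SameColour (colouring enum S) (colouring enum S')) := by
  constructor
  · rintro ⟨B, hB, h0⟩
    exact ⟨B, ⟨fun H => colour_eq_of_atomicEquiv enum (hB.sub H), hB.forth, hB.back⟩, h0⟩
  · rintro ⟨B, hB, h0⟩
    refine ⟨B, ⟨fun {n s t} H θ hθ => ?_, hB.forth, hB.back⟩, h0⟩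
    -- Padding to length `m + 1` places the truth value of `θ` in the last binary digit of the
    -- colour. The padding is irrelevant because `θ` only mentions the first `n` entries.
    obtain ⟨m, hnm, hm⟩ := henum ⟨n, θ, hθ⟩ n
    obtain ⟨k, rfl⟩ := Nat.exists_eq_add_of_le hnm
    obtain ⟨s', t', hB', hs, ht, -⟩ := hB.extend H (k + 1) fun _ => Classical.arbitrary X
    have hcol : colour enum S (n + k + 1) s' = colour enum S' (n + k + 1) t' := hB.sub hB'
    have htr : ∀ (T : L.Structure X) (u : Fin n → X) (u' : Fin (n + (k + 1)) → X),
        (∀ i, u' (Fin.castAdd (k + 1) i) = u i) →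
        (@Formula.Realize L X T _ θ u ↔ TupleRealize T (enum (n + k)) u') := by
      intro T u u' hu
      rw [hm, show u = fun i => u' (Fin.castAdd (k + 1) i) from funext fun i => (hu i).symm]
      exact ⟨fun h => ⟨Nat.le_add_right n (k + 1), h⟩, fun ⟨_, h⟩ => h⟩
    rw [htr S s s' hs, htr S' t t' ht]
    simp only [colour] at hcol
    split_ifs at hcol with h1 h2 h2
    · exact iff_of_true h1 h2
    · omega
    · omega
    · exact iff_of_false h1 h2

theorem exists_enumeration [Countable L.Symbols] :
    ∃ enum : ℕ → AtomicFormula L, ∀ θ n, ∃ m, n ≤ m ∧ enum m = θ := by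
  have : Nonempty (AtomicFormula L) :=
    ⟨1, (Term.var 0).equal (Term.var 0), .equal _ _⟩
  obtain ⟨f, hf⟩ := exists_surjective_nat (AtomicFormula L)
  refine ⟨fun m => f m.unpair.1, fun θ n => ?_⟩
  obtain ⟨i, rfl⟩ := hf θ
  exact ⟨Nat.pair i n, Nat.right_le_pair i n, by simp only [Nat.unpair_pair]⟩

end Colour

/-! ### The reduction -/

section Reduction

variable {L : FirstOrder.Language.{0, 0}} {X : Type u}
  {Ψ : InfSentence L (ℵ₁ : Cardinal.{0})}

/-- The model of `REF(inf)` that codes a structure. -/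
noncomputable def codeModel [Infinite X] (enum : ℕ → AtomicFormula L) (M : Mod Ψ X) : Mod refInf X :=
  ⟨prefixStructure (pathOf (colouring enum M.1)),
    holds_refInf_pathOf (isBinaryColouring_colouring enum M.1)⟩

theorem backForth_codeModel_iff [Infinite X] {enum : ℕ → AtomicFormula L}
    (henum : ∀ θ n, ∃ m, n ≤ m ∧ enum m = θ) (M N : Mod Ψ X) :
    BackForth (AtomicEquiv M.1 N.1) ↔
      BackForth (AtomicEquiv (codeModel enum M).1 (codeModel enum N).1) :=
  (backForth_colouring_iff henum).trans
    (backForth_pathOf_iff (isBinaryColouring_colouring enum _)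
      (isBinaryColouring_colouring enum _))

/-- A colour depends on finitely many atomic statements about fixed elements. Allowing any
$\sigma$-algebra that contains the sub-basis covers the Borel and the $\lambda$-Borel case together.
-/
theorem measurable_colour (enum : ℕ → AtomicFormula L) [m : MeasurableSpace (Mod Ψ X)]
    (hm : ∀ U ∈ Mod.subbasis Ψ X, MeasurableSet U) (n : ℕ) (t : Fin n → X) :
    Measurable fun M : Mod Ψ X => colour enum M.1 n t := by
  classical
  induction n with
  | zero => exact measurable_const
  | succ n ih =>
    have hS : MeasurableSet {M : Mod Ψ X | TupleRealize M.1 (enum n) t} := by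
      by_cases hk : (enum n).1 ≤ n + 1
      · refine hm _ ⟨_, (enum n).2.1, fun i => t (Fin.castLE hk i),
          BoundedFormula.IsAtomic.isQF (enum n).2.2, ?_⟩
        ext M
        exact ⟨fun ⟨_, h⟩ => h, fun h => ⟨hk, h⟩⟩
      · convert MeasurableSet.empty
        ext M
        exact iff_of_false (fun h => hk h.1) (Set.notMem_empty M)
    simp only [colour]
    exact ((ih _).const_mul 2).add (Measurable.ite hS measurable_const measurable_const)

/-- As `M` varies, the path of a fixed element takes at most two values, selected by a measurable
condition on one colour. The set is thus a finite Boolean combination. -/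
theorem measurableSet_agree_pathOf [Infinite X] (enum : ℕ → AtomicFormula L) [m : MeasurableSpace (Mod Ψ X)]
    (hm : ∀ U ∈ Mod.subbasis Ψ X, MeasurableSet U) (n : ℕ) (x y : X) :
    MeasurableSet {M : Mod Ψ X |
      Agree n (pathOf (colouring enum M.1) x) (pathOf (colouring enum M.1) y)} := by
  have key : ∀ x : X, ∃ (A : Set (Mod Ψ X)) (p q : ℕ → Move X), MeasurableSet A ∧
      ∀ M : Mod Ψ X, (M ∈ A → pathOf (colouring enum M.1) x = p) ∧
        (M ∉ A → pathOf (colouring enum M.1) x = q) := by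
    intro x
    rcases hx : (pathEquiv X x).1.final with _ | t
    · refine ⟨Set.univ, (pathEquiv X x).1.1, (pathEquiv X x).1.1, MeasurableSet.univ,
        fun M => ⟨fun _ => ?_, fun h => absurd (Set.mem_univ M) h⟩⟩
      simp only [pathOf, codePath, hx]
    · refine ⟨{M | (pathEquiv X x).2 < colour enum M.1 t.1 t.2}, (pathEquiv X x).1.1,
        (deadPath X).1, measurableSet_lt measurable_const (measurable_colour enum hm t.1 t.2),
        fun M => ⟨fun h => ?_, fun h => ?_⟩⟩
      · simp only [pathOf, codePath, hx]
        exact congrArg Subtype.val (if_pos h)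
      · simp only [pathOf, codePath, hx]
        exact congrArg Subtype.val (if_neg h)
  obtain ⟨A, p, q, hA, hpq⟩ := key x
  obtain ⟨A', p', q', hA', hpq'⟩ := key y
  have : {M : Mod Ψ X |
      Agree n (pathOf (colouring enum M.1) x) (pathOf (colouring enum M.1) y)} =
      (A ∩ A' ∩ {_M | Agree n p p'}) ∪ (A ∩ A'ᶜ ∩ {_M | Agree n p q'}) ∪
      (Aᶜ ∩ A' ∩ {_M | Agree n q p'}) ∪ (Aᶜ ∩ A'ᶜ ∩ {_M | Agree n q q'}) := by
    ext M
    by_cases h : M ∈ A <;> by_cases h' : M ∈ A' <;> simp [h, h', hpq M, hpq' M]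
  rw [this]
  exact ((((hA.inter hA').inter (.const _)).union ((hA.inter hA'.compl).inter (.const _))).union
    ((hA.compl.inter hA').inter (.const _))).union ((hA.compl.inter hA'.compl).inter (.const _))

theorem measurableSet_preimage_codeModel [Infinite X] (enum : ℕ → AtomicFormula L)
    [m : MeasurableSpace (Mod Ψ X)] (hm : ∀ U ∈ Mod.subbasis Ψ X, MeasurableSet U)
    {U : Set (Mod refInf X)} (hU : U ∈ Mod.subbasis refInf X) :
    MeasurableSet (codeModel (Ψ := Ψ) enum ⁻¹' U) := by
  obtain ⟨n, θ, a, hθ, rfl⟩ := hU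
  have key : ∀ {l : ℕ} (φ : refLanguage.BoundedFormula (Fin n) l) (b : Fin l → X), φ.IsQF →
      MeasurableSet {M : Mod Ψ X |
        @BoundedFormula.Realize _ X (codeModel enum M).1 _ _ φ a b} := by
    intro l φ b hφ
    induction hφ with
    | falsum => exact MeasurableSet.empty
    | of_isAtomic h =>
      have hterm : ∀ t : refLanguage.Term (Fin n ⊕ Fin l), ∃ x : X, ∀ M : Mod Ψ X,
          @Term.realize _ X (codeModel enum M).1 _ (Sum.elim a b) t = x := by
        rintro (i | f)
        · exact ⟨Sum.elim a b i, fun _ => rfl⟩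
        · exact f.elim
      cases h with
      | equal s t =>
        obtain ⟨x, hx⟩ := hterm s
        obtain ⟨y, hy⟩ := hterm t
        simp only [BoundedFormula.realize_bdEqual, hx, hy]
        exact .const _
      | rel R ts =>
        obtain ⟨k⟩ := R
        obtain ⟨x, hx⟩ := hterm (ts 0)
        obtain ⟨y, hy⟩ := hterm (ts 1)
        convert measurableSet_agree_pathOf (Ψ := Ψ) enum hm k x y using 1
        ext M
        rw [Set.mem_ofPred_eq, Set.mem_ofPred_eq, ← hx M, ← hy M]
        rfl
    | imp _ _ h1 h2 =>
      simp only [BoundedFormula.realize_imp]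
      exact h1.imp h2
  exact key θ default hθ

end Reduction

/-! ### Borel completeness -/

theorem countable_subbasis {L : FirstOrder.Language.{0, 0}} [Countable L.Symbols]
    (Φ : InfSentence L (ℵ₁ : Cardinal.{0})) : (Mod.subbasis Φ ℕ).Countable := by
  refine (Set.countable_range fun p : Σ n, L.Formula (Fin n) × (Fin n → ℕ) =>
    Mod.basicSet Φ p.2.1 p.2.2).mono ?_
  rintro _ ⟨n, θ, a, -, rfl⟩
  exact ⟨⟨n, θ, a⟩, rfl⟩

theorem borelComplete_refInf : BorelComplete refInf := by
  intro L' _ Ψ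
  obtain ⟨enum, henum⟩ := exists_enumeration (L := L')
  refine ⟨codeModel enum, ?_, fun M N => ?_⟩
  · have : Countable refLanguage.Symbols := by
      refine Function.Surjective.countable (f := fun n : ℕ => Sum.inr ⟨2, RefRel.E n⟩) ?_
      rintro (⟨_, f⟩ | ⟨_, ⟨n⟩⟩)
      · exact f.elim
      · exact ⟨n, rfl⟩
    -- Second countability lets the sub-basis generate the Borel $\sigma$-algebra of the target. In
    -- the source it is enough that sub-basic sets are Borel.
    have hsc : SecondCountableTopology (Mod refInf ℕ) :=
      ⟨⟨_, countable_subbasis refInf, rfl⟩⟩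
    rw [borel_eq_generateFrom_of_subbasis (s := Mod.subbasis refInf ℕ) rfl]
    let _ : MeasurableSpace (Mod Ψ ℕ) := borel (Mod Ψ ℕ)
    refine measurable_generateFrom fun U hU => measurableSet_preimage_codeModel enum ?_ hU
    exact fun V hV => MeasurableSpace.measurableSet_generateFrom (.basic V hV)
  · exact nonempty_equiv_iff_backForth.trans
      ((backForth_codeModel_iff henum M N).trans nonempty_equiv_iff_backForth.symm)

/-- The `λ`-Borel sets form a `σ`-algebra. -/
@[reducible]
def lambdaBorelSpace {lam : Cardinal.{u}} (hlam : ℵ₀ ≤ lam) {Y : Type u} (B : Set (Set Y)) :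
    MeasurableSpace Y where
  MeasurableSet' := LambdaBorel lam B
  measurableSet_empty := by
    have := LambdaBorel.iUnion (lam := lam) (B := B) PEmpty (by simp) (fun i => i.elim)
      fun i => i.elim
    rwa [Set.iUnion_of_empty] at this
  measurableSet_compl := .compl
  measurableSet_iUnion f hf := by
    have := LambdaBorel.iUnion (lam := lam) (B := B) (ULift.{u} ℕ) (by simpa using hlam)
      (fun i => f i.down) fun i => hf i.down
    exact Equiv.ulift.{u}.surjective.iUnion_comp f ▸ this

theorem lambdaBorelComplete_refInf (lam : Cardinal.{u}) (hlam : ℵ₀ ≤ lam) :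
    LambdaBorelComplete lam refInf := by
  intro L' _ Ψ
  obtain ⟨enum, henum⟩ := exists_enumeration (L := L')
  have : Infinite lam.ord.ToType := by
    rw [Cardinal.infinite_iff, mk_ord_toType]
    exact hlam
  refine ⟨codeModel enum, fun U hU => ?_, fun M N => ?_⟩
  · exact measurableSet_preimage_codeModel
      (m := lambdaBorelSpace hlam (Mod.subbasis Ψ lam.ord.ToType)) enum
      (fun V hV => show LambdaBorel lam _ V from .basic V hV) hU
  · exact infEquiv_iff_backForth.trans
      ((backForth_codeModel_iff henum M N).trans infEquiv_iff_backForth.symm)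

end BorelComplexity

theorem mainTheorem8 :
    BorelComplexity.BorelComplete BorelComplexity.refInf ∧
      ∀ lam : Cardinal.{u}, Cardinal.aleph0 ≤ lam →
        BorelComplexity.LambdaBorelComplete lam BorelComplexity.refInf :=
  ⟨BorelComplexity.borelComplete_refInf, BorelComplexity.lambdaBorelComplete_refInf⟩
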